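/- Call the equation $ax+by=p(z)$ \emph{2-Ramsey} if every colouring of the positive integers with two colours admits infinitely many monochromatic solutions, i.e. infinitely many triples $(x,y,z)$ of positive integers with $ax+by=p(z)$ such that $x,y,z$ all have the same colour. Theorem. Suppose that $p\in\mathbb{Z}[z]$ is a polynomial of degree at least 2 with a positive leading coefficient, and let $a$ and $b$ be positive integers with $\gcd(a,b)=1$. Also suppose that there exist positive integers $d$ and $u$, and integers $t$ and $v$, such that the following six conditions hold for all integers $j,k$: 1. $(a+b)t\equiv p(t)\pmod d$; 2. if $k\equiv t\pmod d$, then $a\mid p(k+d)-p(k)$; 3. if $k\equiv t\pmod d$, then, letting $m=\frac{p(k+d)-p(k)}{a}$ and $m'=\frac{m}{u}$, we have $u\mid m$, $2\nmid m'$ and $\gcd(a,m')=\gcd(b,m')=\gcd(u,m')=1$; 4. $p(v)\equiv(a+b)v\pmod u$; 5. if $k\equiv t\pmod d$, then $p(k)\equiv(a+b)v\pmod u$; 6. if $j\equiv v\pmod u$ and $k\equiv t\pmod d$, then $b\mid p(k)-aj$. Then the equation $ax+by=p(z)$ is 2-Ramsey. -/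

import Mathlib

/-- The equation `a x + b y = p(z)` is `r`-Ramsey: every `r`-colouring of the positive integers
admits infinitely many monochromatic solutions `(x, y, z)` in positive integers. -/
def IsRamseyEquation (r : ℕ) (a b : ℤ) (p : Polynomial ℤ) : Prop :=
  ∀ φ : ℕ+ → Fin r,
    {s : ℕ+ × ℕ+ × ℕ+ |
      a * (s.1 : ℤ) + b * (s.2.1 : ℤ) = p.eval (s.2.2 : ℤ) ∧
      φ s.1 = φ s.2.1 ∧ φ s.2.1 = φ s.2.2}.Infinite

/-- The integer `m = (p(k+d) - p(k)) / a`; the division is exact whenever `a ∣ p(k+d) - p(k)`. -/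
def stepQuotient (p : Polynomial ℤ) (a d k : ℤ) : ℤ :=
  (p.eval (k + d) - p.eval k) / a

/-!
Suppose that a 2-colouring has no monochromatic solution with large `z`. Restrict `z` to the class of
`t` modulo `d`, and `x`, `y` to the class of `v` modulo `u`. If `z` and `z'` have different colours,
then `x` and `x' = x + (p(z') - p(z)) / a` share a `y` with `a x + b y = p(z)` and
`a x' + b y = p(z')`, so the colour of `z` passes from `x` to `x'`
(`NoMonoSolution.transfer`). A colour change between `k` and `k + d` thus makes the colour of `k`
stable under the step `m = (p(k + d) - p(k)) / a`, which is tiny compared to `p(k)`. Such changes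
occur arbitrarily far out in both directions (`NoMonoSolution.exists_switch`).

Parity enters through `NoMonoSolution.two_mul_card_lt`. If a colour is forced on certain residue
classes modulo `u g` near `p(k) / (a + b)`, where `g` is odd and coprime to `a b`, then the solutions
of `a x + b y = p(k)` with `x`, `y` near this point pair these classes injectively with other
ones, so they make up strictly less than half of all classes.

Let `k` be far out with a colour change to `k + d`.
* If the opposite change occurs shortly before `k`, the colour of `k` is stable under a
  forward and a backward step, hence the colouring is periodic near `p(k) / (a + b)`
  (`pred_of_gcd_dvd`), and each colour would fill less than half of the classes:
  `NoMonoSolution.not_near_switch`.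
* Otherwise `k` ends a long run of its colour, which is therefore stable under all steps
  `(p(k + d) - p(k - i d)) / a` with `i ≤ D h`, where `D = deg p` and `h = 2 ^ s` is about a
  small constant times `k`. Iterated differences of order `D` with steps `1, 2, 4, …, h` show that sums of these
  steps contain every multiple of `gcd (G, m)` beyond a small fraction of `p(k)`
  (`mem_closure_of_gcd_dvd`), where `G = D! lead(p) d ^ D / a` does not depend on `k`. Hence one small
  `x` with the colour of `k` forces its whole class near `p(k) / (a + b)`, so this colour
  is rare among small representatives: `NoMonoSolution.two_mul_card_low_lt`.

Since `G` is fixed, the last conclusion holds for the same small representatives with both colours,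
using one change of each direction, and the two minorities cannot add up to everything
(`IsAdmissible.not_noMonoSolution`).
-/

/-! ### Growth and finite differences of integer polynomials -/

open Polynomial in
theorem exists_abs_eval_le (q : ℤ[X]) {n : ℕ} (hn : q.natDegree ≤ n) :
    ∃ C : ℤ, 0 < C ∧ ∀ k : ℤ, 1 ≤ k → |q.eval k| ≤ C * k ^ n := by
  refine ⟨∑ i ∈ Finset.range (q.natDegree + 1), |q.coeff i| + 1, by positivity, fun k hk => ?_⟩
  rw [eval_eq_sum_range]
  calc |∑ i ∈ Finset.range (q.natDegree + 1), q.coeff i * k ^ i|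
      ≤ ∑ i ∈ Finset.range (q.natDegree + 1), |q.coeff i * k ^ i| := Finset.abs_sum_le_sum_abs _ _
    _ ≤ ∑ i ∈ Finset.range (q.natDegree + 1), |q.coeff i| * k ^ n := by
        refine Finset.sum_le_sum fun i hi => ?_
        have hi' : i ≤ n := by have := Finset.mem_range.mp hi; omega
        rw [abs_mul, abs_of_nonneg (by positivity : (0 : ℤ) ≤ k ^ i)]
        exact mul_le_mul_of_nonneg_left (pow_le_pow_right₀ hk hi') (abs_nonneg _)
    _ ≤ _ := by
        rw [← Finset.sum_mul, add_mul]
        have : (0 : ℤ) ≤ k ^ n := by positivity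
        linarith

open Polynomial in
theorem exists_pow_natDegree_le_two_mul_eval (q : ℤ[X]) (hq : 0 < q.leadingCoeff) :
    ∃ N : ℤ, 1 ≤ N ∧ ∀ k : ℤ, N ≤ k → k ^ q.natDegree ≤ 2 * q.eval k := by
  rcases Nat.eq_zero_or_pos q.natDegree with h0 | h0
  · refine ⟨1, le_rfl, fun k _ => ?_⟩
    rw [eq_C_of_natDegree_eq_zero h0] at hq ⊢
    simp only [leadingCoeff_C, natDegree_C, pow_zero, eval_C] at hq ⊢
    omega
  · obtain ⟨n, hn⟩ : ∃ n, q.natDegree = n + 1 := ⟨q.natDegree - 1, by omega⟩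
    obtain ⟨C, hC, hle⟩ := exists_abs_eval_le q.eraseLead (n := n)
      ((eraseLead_natDegree_le q).trans (by omega))
    refine ⟨2 * C, by omega, fun k hk => ?_⟩
    have hk1 : 1 ≤ k := by omega
    have h1 := (abs_le.mp (hle k hk1)).1
    have h2 : q.eval k = q.eraseLead.eval k + q.leadingCoeff * k ^ (n + 1) := by
      conv_lhs => rw [← eraseLead_add_C_mul_X_pow q]
      simp [hn]
    have h3 : (0 : ℤ) < k ^ n := by positivity
    have h4 : 2 * C * k ^ n ≤ k ^ (n + 1) := by
      rw [pow_succ']; exact mul_le_mul_of_nonneg_right hk h3.le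
    have h5 : k ^ (n + 1) ≤ q.leadingCoeff * k ^ (n + 1) :=
      le_mul_of_one_le_left (by positivity) (by omega)
    rw [hn, h2]
    linarith

open Polynomial in
theorem coeff_taylor_natDegree_sub_one (p : ℤ[X]) (hp : 1 ≤ p.natDegree) (d : ℤ) :
    (taylor d p).coeff (p.natDegree - 1)
      = p.coeff (p.natDegree - 1) + p.natDegree * p.leadingCoeff * d := by
  obtain ⟨n, hn⟩ : ∃ n, p.natDegree = n + 1 := ⟨p.natDegree - 1, by omega⟩
  rw [taylor_coeff, eval_eq_sum_range' (n := 2)]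
  · simp only [Finset.sum_range_succ, Finset.sum_range_zero, hasseDeriv_coeff, leadingCoeff, hn]
    simp [Nat.add_comm 1 n]
  · have := natDegree_hasseDeriv_le p (p.natDegree - 1)
    omega

open Polynomial in
/-- The increment `p(k+d) - p(k)` is a polynomial in `k` of degree `deg p - 1` with positive leading
coefficient. -/
theorem exists_increment_bounds (p : ℤ[X]) (hp : 1 ≤ p.natDegree) (hl : 0 < p.leadingCoeff)
    {d : ℤ} (hd : 0 < d) :
    ∃ C N : ℤ, 0 < C ∧ 1 ≤ N ∧ ∀ k : ℤ, N ≤ k →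
      0 < p.eval (k + d) - p.eval k ∧ p.eval (k + d) - p.eval k ≤ C * k ^ (p.natDegree - 1) := by
  set r := taylor d p - p with hr
  have hev (k : ℤ) : p.eval (k + d) - p.eval k = r.eval k := by
    simp [hr, taylor_eval, add_comm]
  have hle : r.natDegree ≤ p.natDegree - 1 := by
    rw [natDegree_le_iff_coeff_eq_zero]
    intro m hm
    rcases (show p.natDegree ≤ m by omega).eq_or_lt with rfl | h
    · simp [hr]
    · rw [hr, coeff_sub, coeff_eq_zero_of_natDegree_lt h,
        coeff_eq_zero_of_natDegree_lt (by rwa [natDegree_taylor]), sub_zero]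
  have hc : 0 < r.coeff (p.natDegree - 1) := by
    rw [hr, coeff_sub, coeff_taylor_natDegree_sub_one p hp]
    have : (0 : ℤ) < p.natDegree := by exact_mod_cast hp
    have : 0 < (p.natDegree : ℤ) * p.leadingCoeff * d := by positivity
    linarith
  have hdeg : r.natDegree = p.natDegree - 1 := natDegree_eq_of_le_of_coeff_ne_zero hle hc.ne'
  obtain ⟨C, hC, hub⟩ := exists_abs_eval_le r hle
  obtain ⟨N, hN, hlb⟩ := exists_pow_natDegree_le_two_mul_eval r
    (by rwa [leadingCoeff, hdeg])
  refine ⟨C, N, hC, hN, fun k hk => ?_⟩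
  have hk1 : 1 ≤ k := hN.trans hk
  rw [hev]
  refine ⟨?_, (le_abs_self _).trans (hub k hk1)⟩
  have h1 := hlb k hk
  have h2 : 0 < k ^ r.natDegree := by positivity
  omega

open Polynomial in
/-- The backward difference of order `deg p` with step `e` is constant. -/
theorem alternating_sum_eval (p : ℤ[X]) (k : ℤ) {e : ℤ} (he : e ≠ 0) :
    ∑ i ∈ Finset.range (p.natDegree + 1), (-1) ^ i * (p.natDegree.choose i : ℤ) * p.eval (k - i * e)
      = p.natDegree.factorial * p.leadingCoeff * e ^ p.natDegree := by
  set l : ℤ[X] := C (-e) * X + C k with hl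
  have hlc : l.leadingCoeff = -e := leadingCoeff_linear (neg_ne_zero.mpr he)
  have hl1 : l.natDegree = 1 := natDegree_linear (neg_ne_zero.mpr he)
  have hnd : (p.comp l).natDegree = p.natDegree := by rw [natDegree_comp, hl1, mul_one]
  have h := congrFun (fwdDiff_iter_degree_eq_factorial (p.comp l)) 0
  rw [fwdDiff_iter_eq_sum_shift, hnd, leadingCoeff_comp (by omega), hlc] at h
  have hev (i : ℕ) : (p.comp l).eval (0 + i • (1 : ℤ)) = p.eval (k - i * e) := by
    rw [eval_comp]; congr 1; simp [hl]; ring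
  simp only [hev, Pi.smul_apply, smul_eq_mul, Pi.natCast_apply] at h
  have hsign : ((-1 : ℤ) ^ p.natDegree) * (-1) ^ p.natDegree = 1 := by
    rw [← mul_pow]; simp
  calc _ = (-1) ^ p.natDegree * ∑ i ∈ Finset.range (p.natDegree + 1),
        (-1) ^ (p.natDegree - i) * (p.natDegree.choose i : ℤ) * p.eval (k - i * e) := by
        rw [Finset.mul_sum]
        refine Finset.sum_congr rfl fun i hi => ?_
        have hi' : i ≤ p.natDegree := by have := Finset.mem_range.mp hi; omega
        obtain ⟨j, hj⟩ := Nat.exists_eq_add_of_le hi'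
        rw [hj, Nat.add_sub_cancel_left, pow_add]
        have : ((-1 : ℤ) ^ j) * (-1) ^ j = 1 := by rw [← mul_pow]; simp
        linear_combination (-(-1 : ℤ) ^ i * ((i + j).choose i : ℤ) * eval (k - i * e) p) * this
    _ = _ := by
        rw [h, neg_pow]
        linear_combination
          (p.leadingCoeff * e ^ p.natDegree * (p.natDegree.factorial : ℤ)) * hsign

/-- Scales for the filling argument: for every large `k` there is a dyadic `h = 2^s` whose power
`h ^ deg p` exceeds all increments of `p` near `k`, while `h` increments are still negligible
compared to `p(k)`. -/
theorem exists_dyadic_scale (p : Polynomial ℤ) (hp : 2 ≤ p.natDegree) (hl : 0 < p.leadingCoeff)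
    {d : ℤ} (hd : 0 < d) (K : ℤ) :
    ∃ N : ℤ, K ≤ N ∧ ∀ k : ℤ, N ≤ k → ∃ (s : ℕ) (M : ℤ), K ≤ M ∧ 0 < M ∧
      M ≤ 2 ^ (p.natDegree * s) ∧ K * (2 ^ s * M) ≤ p.eval k ∧
      K ≤ k - p.natDegree * 2 ^ s * d ∧
      ∀ w : ℤ, k - p.natDegree * 2 ^ s * d ≤ w → w ≤ k →
        0 < p.eval (w + d) - p.eval w ∧ p.eval (w + d) - p.eval w ≤ M := by
  set D := p.natDegree with hD
  obtain ⟨C, N₁, hC, hN₁, hinc⟩ := exists_increment_bounds p (by omega) hl hd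
  obtain ⟨N₂, hN₂, hbig⟩ := exists_pow_natDegree_le_two_mul_eval p hl
  set L : ℤ := |K| + 1 with hL
  have hLpos : 0 < L := by positivity
  have hKL : K ≤ L := (le_abs_self K).trans (by omega)
  have hDpos : (0 : ℤ) < D := by exact_mod_cast (by omega : 0 < D)
  -- `h ≤ k / Q` makes `h` increments at most `p(k) / K`, and keeps `k - D h d ≥ k / 2`.
  set Q : ℤ := 2 * L * C + 2 * D * d with hQ
  have hQpos : 0 < Q := by positivity
  refine ⟨N₁ * 2 + N₂ + 2 * L + C * (2 * Q) ^ D + Q, ?_, fun k hk => ?_⟩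
  · have : 0 < C * (2 * Q) ^ D := by positivity
    omega
  have hCQ : 0 < C * (2 * Q) ^ D := by positivity
  have hkQ : Q ≤ k := by omega
  have hkpos : 0 < k := by omega
  obtain ⟨s, hs1, hs2⟩ : ∃ s : ℕ, 2 ^ s * Q ≤ k ∧ k < 2 ^ (s + 1) * Q := by
    have hq : 1 ≤ k / Q := by rw [Int.le_ediv_iff_mul_le hQpos]; omega
    refine ⟨Nat.log 2 (k / Q).toNat, ?_, ?_⟩
    · have := Nat.pow_log_le_self 2 (x := (k / Q).toNat) (by omega)
      rw [← Int.le_ediv_iff_mul_le hQpos]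
      zify at this
      rwa [Int.toNat_of_nonneg (by omega)] at this
    · have := Nat.lt_pow_succ_log_self (b := 2) (by norm_num) (k / Q).toNat
      rw [← Int.ediv_lt_iff_lt_mul hQpos]
      zify at this
      rwa [Int.toNat_of_nonneg (by omega)] at this
  have hh : (0 : ℤ) < 2 ^ s := by positivity
  have hkD1 : (0 : ℤ) < k ^ (D - 1) := by positivity
  have hhalf : 2 * (D * 2 ^ s * d) ≤ k := by
    have : 2 ^ s * (2 * D * d) ≤ 2 ^ s * Q := by
      apply mul_le_mul_of_nonneg_left _ hh.le
      have : 0 < 2 * L * C := by positivity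
      omega
    linarith
  have hkD : k * k ^ (D - 1) = k ^ D := by rw [← pow_succ']; congr 1; omega
  refine ⟨s, C * k ^ (D - 1), ?_, by positivity, ?_, ?_, by omega, ?_⟩
  · have h1 : k ≤ k ^ (D - 1) := le_self_pow₀ (by omega) (by omega)
    have h2 : k ^ (D - 1) ≤ C * k ^ (D - 1) := le_mul_of_one_le_left hkD1.le (by omega)
    omega
  · -- From `k < 2 Q h` and `C (2 Q)^D ≤ k`.
    have h1 : k ^ D ≤ (2 * Q) ^ D * 2 ^ (D * s) := by
      rw [mul_comm D s, pow_mul, ← mul_pow]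
      apply pow_le_pow_left₀ hkpos.le
      rw [pow_succ] at hs2
      linarith
    have h2 : C * (2 * Q) ^ D * k ^ (D - 1) ≤ k ^ D := by
      rw [← hkD]; exact mul_le_mul_of_nonneg_right (by omega) hkD1.le
    have h3 : (0 : ℤ) < (2 * Q) ^ D := by positivity
    have h4 : (2 * Q) ^ D * (C * k ^ (D - 1)) ≤ (2 * Q) ^ D * 2 ^ (D * s) := by linarith
    exact le_of_mul_le_mul_left h4 h3
  · have h1 := hbig k (by omega)
    have h2 : (2 ^ s * (2 * L * C)) ≤ k := by
      have : 2 ^ s * (2 * L * C) ≤ 2 ^ s * Q := by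
        apply mul_le_mul_of_nonneg_left _ hh.le
        have : 0 < 2 * D * d := by positivity
        omega
      linarith
    have h3 : 2 ^ s * (2 * L * C) * k ^ (D - 1) ≤ k ^ D := by
      rw [← hkD]; exact mul_le_mul_of_nonneg_right h2 hkD1.le
    have h4 : K * (2 ^ s * (C * k ^ (D - 1))) ≤ L * (2 ^ s * (C * k ^ (D - 1))) :=
      mul_le_mul_of_nonneg_right hKL (by positivity)
    linarith
  · intro w hw1 hw2
    obtain ⟨h1, h2⟩ := hinc w (by omega)
    refine ⟨h1, h2.trans ?_⟩
    exact mul_le_mul_of_nonneg_left (pow_le_pow_left₀ (by omega) hw2 _) hC.le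

/-! ### Additive submonoids of the integers containing long progressions -/

theorem AddSubmonoid.int_mul_mem {S : AddSubmonoid ℤ} {c x : ℤ} (hc : 0 ≤ c) (hx : x ∈ S) :
    c * x ∈ S := by
  lift c to ℕ using hc
  simpa using S.nsmul_mem hx c

/-- A sequence whose `D`-th differences with step `h` are `-G h ^ D`: splitting the alternating sum
by parity gives two nonnegative combinations of its terms that differ by `G h ^ D`. -/
theorem exists_mem_and_add_mem {α : ℕ → ℤ} {D : ℕ} {G M : ℤ} {h n : ℕ} (hh : 1 ≤ h) (hn : D * h ≤ n)
    (hdiff : ∑ i ∈ Finset.range (D + 1), (-1) ^ i * (D.choose i : ℤ) * α (i * h) = -(G * h ^ D))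
    (hpos : ∀ i ≤ n, 0 < α i) (hle : ∀ i ≤ n, α i ≤ (i + 1) * M) (hM : 0 < M) :
    ∃ E : ℤ, 0 ≤ E ∧ E ≤ 2 ^ D * (D + 1) * (h * M) ∧
      E ∈ AddSubmonoid.closure (α '' {i | i ≤ n}) ∧
      E + G * h ^ D ∈ AddSubmonoid.closure (α '' {i | i ≤ n}) := by
  set S := AddSubmonoid.closure (α '' {i | i ≤ n})
  have hin : ∀ i ∈ Finset.range (D + 1), i * h ≤ D * h := fun i hi =>
    Nat.mul_le_mul_right _ (by have := Finset.mem_range.mp hi; omega)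
  have hmem : ∀ i ∈ Finset.range (D + 1), (D.choose i : ℤ) * α (i * h) ∈ S := fun i hi =>
    AddSubmonoid.int_mul_mem (by positivity)
      (AddSubmonoid.subset_closure ⟨_, (hin i hi).trans hn, rfl⟩)
  have hnn : ∀ i ∈ Finset.range (D + 1), 0 ≤ (D.choose i : ℤ) * α (i * h) := fun i hi =>
    mul_nonneg (by positivity) (hpos _ ((hin i hi).trans hn)).le
  set E := ∑ i ∈ Finset.range (D + 1) with Even i, (D.choose i : ℤ) * α (i * h) with hE
  set O := ∑ i ∈ Finset.range (D + 1) with ¬ Even i, (D.choose i : ℤ) * α (i * h) with hO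
  have hEO : E - O = -(G * h ^ D) := by
    rw [← hdiff, ← Finset.sum_filter_add_sum_filter_not _ (fun i => Even i), hE, hO,
      sub_eq_add_neg, ← Finset.sum_neg_distrib]
    congr 1
    · refine Finset.sum_congr rfl fun i hi => ?_
      rw [(Finset.mem_filter.mp hi).2.neg_one_pow]; ring
    · refine Finset.sum_congr rfl fun i hi => ?_
      rw [(Nat.not_even_iff_odd.mp (Finset.mem_filter.mp hi).2).neg_one_pow]; ring
  refine ⟨E, Finset.sum_nonneg fun i hi => hnn i (Finset.mem_filter.mp hi).1, ?_,
    sum_mem fun i hi => hmem i (Finset.mem_filter.mp hi).1, ?_⟩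
  · calc E ≤ ∑ i ∈ Finset.range (D + 1), (D.choose i : ℤ) * α (i * h) :=
          Finset.sum_le_sum_of_subset_of_nonneg (Finset.filter_subset _ _)
            fun i hi _ => hnn i hi
      _ ≤ ∑ i ∈ Finset.range (D + 1), (D.choose i : ℤ) * ((D + 1) * (h * M)) := by
          refine Finset.sum_le_sum fun i hi => mul_le_mul_of_nonneg_left ?_ (by positivity)
          refine (hle _ ((hin i hi).trans hn)).trans ?_
          have h1 : ((i * h : ℕ) : ℤ) ≤ D * h := by exact_mod_cast hin i hi
          have h2 : (1 : ℤ) ≤ h := by exact_mod_cast hh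
          rw [← mul_assoc]
          exact mul_le_mul_of_nonneg_right (by linarith) hM.le
      _ = _ := by
          rw [← Finset.sum_mul, mul_assoc]
          congr 1
          exact_mod_cast Nat.sum_range_choose D
  · rw [show E + G * h ^ D = O by linarith]
    exact sum_mem fun i hi => hmem i (Finset.mem_filter.mp hi).1

/-- Doubling the step: `2 ^ D - 1` copies of a step that may be prolonged by `G h ^ D` turn a block
of `h ^ D` consecutive multiples of `G` into one of `(2 h) ^ D`. The total cost of all doublings is
a geometric sum. Every step is used `G` times, so that the block starts at a multiple of `G`. -/
theorem exists_block_mem {α : ℕ → ℤ} {D : ℕ} {G M : ℤ} {n : ℕ} (hG : 0 < G) (hM : 0 < M)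
    (hdiff : ∀ h : ℕ, 1 ≤ h →
      ∑ i ∈ Finset.range (D + 1), (-1) ^ i * (D.choose i : ℤ) * α (i * h) = -(G * h ^ D))
    (hpos : ∀ i ≤ n, 0 < α i) (hle : ∀ i ≤ n, α i ≤ (i + 1) * M) (s : ℕ) (hn : D * 2 ^ s ≤ n) :
    ∃ B : ℤ, G ∣ B ∧ 0 ≤ B ∧ B ≤ 4 ^ D * G * (D + 1) * (2 ^ s * M) ∧
      ∀ r : ℤ, 0 ≤ r → r < 2 ^ (D * s) →
        B + r * G ∈ AddSubmonoid.closure (α '' {i | i ≤ n}) := by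
  induction s with
  | zero =>
    refine ⟨0, dvd_zero _, le_rfl, by positivity, fun r h0 h1 => ?_⟩
    obtain rfl : r = 0 := by
      simp only [mul_zero, pow_zero] at h1
      omega
    simp
  | succ s ih =>
    have hn' : D * 2 ^ s ≤ n := le_trans (Nat.mul_le_mul_left _ (by gcongr <;> omega)) hn
    obtain ⟨B, hGB, hB0, hBle, hB⟩ := ih hn'
    obtain ⟨E, hE0, hEle, hE, hEG⟩ := exists_mem_and_add_mem (h := 2 ^ s) Nat.one_le_two_pow hn'
      (hdiff _ Nat.one_le_two_pow) hpos hle hM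
    push_cast at hEle hEG
    have h2D : (1 : ℤ) ≤ 2 ^ D := one_le_pow₀ (by norm_num)
    refine ⟨B + (2 ^ D - 1) * (G * E), dvd_add hGB (Dvd.dvd.mul_left (dvd_mul_right _ _) _),
      by have : 0 ≤ G * E := by positivity
         have := mul_nonneg (sub_nonneg.mpr h2D) this
         omega, ?_, fun r hr0 hr1 => ?_⟩
    · have h4 : (4 : ℤ) ^ D = 2 ^ D * 2 ^ D := by rw [← mul_pow]; norm_num
      have h1 : (2 ^ D - 1) * (G * E) ≤ 2 ^ D * (G * (2 ^ D * (D + 1) * (2 ^ s * M))) := by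
        apply mul_le_mul (by linarith) _ (by positivity) (by positivity)
        exact mul_le_mul_of_nonneg_left hEle hG.le
      rw [h4] at hBle ⊢
      rw [pow_succ]
      linarith
    · set b : ℤ := 2 ^ (D * s) with hb
      have hbpos : 0 < b := by positivity
      have hq0 : 0 ≤ r / b := Int.ediv_nonneg hr0 hbpos.le
      have hq1 : r / b < 2 ^ D := by
        rw [Int.ediv_lt_iff_lt_mul hbpos, hb, ← pow_add]
        convert hr1 using 2
        ring
      have hbD : ((2 : ℤ) ^ s) ^ D = b := by rw [hb, ← pow_mul, mul_comm]
      rw [hbD] at hEG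
      have hGE1 : (G - 1) * E + (E + G * b) ∈ AddSubmonoid.closure (α '' {i | i ≤ n}) :=
        add_mem (AddSubmonoid.int_mul_mem (by omega) hE) hEG
      have key := add_mem (add_mem
        (AddSubmonoid.int_mul_mem (show 0 ≤ 2 ^ D - 1 - r / b by omega)
          (AddSubmonoid.int_mul_mem hG.le hE))
        (AddSubmonoid.int_mul_mem hq0 hGE1))
        (hB (r % b) (Int.emod_nonneg _ hbpos.ne') (Int.emod_lt_of_pos _ hbpos))
      have hr := Int.emod_add_mul_ediv r b
      convert key using 1
      linear_combination -G * hr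

/-- All large multiples of `gcd (G, α 0)` belong to the submonoid generated by the sequence. -/
theorem mem_closure_of_gcd_dvd {α : ℕ → ℤ} {D : ℕ} {G M : ℤ} {n : ℕ} (hG : 0 < G) (hM : 0 < M)
    (hdiff : ∀ h : ℕ, 1 ≤ h →
      ∑ i ∈ Finset.range (D + 1), (-1) ^ i * (D.choose i : ℤ) * α (i * h) = -(G * h ^ D))
    (hpos : ∀ i ≤ n, 0 < α i) (hle : ∀ i ≤ n, α i ≤ (i + 1) * M) {s : ℕ} (hn : D * 2 ^ s ≤ n)
    (hMs : M ≤ 2 ^ (D * s)) {N : ℤ} (hdvd : (Int.gcd G (α 0) : ℤ) ∣ N)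
    (hN : G * M + 4 ^ D * G * (D + 1) * (2 ^ s * M) ≤ N) :
    N ∈ AddSubmonoid.closure (α '' {i | i ≤ n}) := by
  obtain ⟨B, hGB, hB0, hBle, hB⟩ := exists_block_mem hG hM hdiff hpos hle s hn
  set m := α 0 with hm
  have hm0 : 0 < m := hpos 0 (Nat.zero_le _)
  have hmM : m ≤ M := by simpa using hle 0 (Nat.zero_le _)
  have hmem : m ∈ AddSubmonoid.closure (α '' {i | i ≤ n}) :=
    AddSubmonoid.subset_closure ⟨0, Nat.zero_le _, rfl⟩
  -- `i` copies of `m` adjust the residue modulo `G`, and the rest is filled by multiples of `G`.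
  obtain ⟨c, hc⟩ := hdvd
  set i := (Int.gcdB G m * c) % G with hi
  have hi0 : 0 ≤ i := Int.emod_nonneg _ hG.ne'
  have hi1 : i < G := Int.emod_lt_of_pos _ hG
  obtain ⟨e, he⟩ : G ∣ N - i * m - B := by
    refine dvd_sub ?_ hGB
    have h1 := Int.emod_add_mul_ediv (Int.gcdB G m * c) G
    rw [← hi] at h1
    refine ⟨Int.gcdA G m * c + m * (Int.gcdB G m * c / G), ?_⟩
    rw [hc, Int.gcd_eq_gcd_ab]
    linear_combination -m * h1
  have him : i * m ≤ G * M := mul_le_mul hi1.le hmM hm0.le hG.le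
  have he0 : 0 ≤ e := by
    have : 0 ≤ G * e := by rw [← he]; linarith
    exact nonneg_of_mul_nonneg_right this hG
  have h1 := Int.emod_add_mul_ediv e m
  have key := add_mem (add_mem (AddSubmonoid.int_mul_mem hi0 hmem)
    (AddSubmonoid.int_mul_mem (mul_nonneg hG.le (Int.ediv_nonneg he0 hm0.le)) hmem))
    (hB (e % m) (Int.emod_nonneg _ hm0.ne')
      ((Int.emod_lt_of_pos _ hm0).trans_le (hmM.trans hMs)))
  convert key using 1
  linear_combination he - G * h1

/-- A predicate stable under `+m` and under `-β` on an interval is stable under all multiples of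
`gcd (m, β)` there: the steps can be ordered so that the path never leaves the interval by more than
one step. -/
theorem pred_of_gcd_dvd {R : ℤ → Prop} {m β lo hi : ℤ} (hm : 0 < m) (hβ : 0 < β)
    (hadd : ∀ x, lo - β ≤ x → x ≤ hi → R x → R (x + m))
    (hsub : ∀ x, lo ≤ x → x ≤ hi + m → R x → R (x - β))
    {x y : ℤ} (hx : lo ≤ x) (hx' : x ≤ hi) (hy : lo ≤ y) (hy' : y ≤ hi)
    (hdvd : (Int.gcd m β : ℤ) ∣ y - x) (hR : R x) : R y := by
  have hlohi : lo ≤ hi := hx.trans hx'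
  have path : ∀ n i j : ℕ, i + j = n → ∀ x, lo - β ≤ x → x ≤ hi + m → y = x + i * m - j * β →
      R x → R y := by
    intro n
    induction n with
    | zero =>
      intro i j hij x _ _ hxy hR
      obtain ⟨rfl, rfl⟩ : i = 0 ∧ j = 0 := by omega
      rw [hxy]; simpa using hR
    | succ n ih =>
      intro i j hij x h1 h2 hxy hR
      by_cases hdown : 0 < j ∧ lo ≤ x
      · obtain ⟨j, rfl⟩ : ∃ j', j = j' + 1 := ⟨j - 1, by omega⟩
        refine ih i j (by omega) (x - β) (by omega) (by omega) ?_ (hsub x hdown.2 h2 hR)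
        push_cast at hxy; linarith
      · have hi0 : i ≠ 0 := by
          rintro rfl
          have : 0 < (j : ℤ) := by omega
          have hj : 0 < (j : ℤ) * β := by positivity
          have hjx : ¬ lo ≤ x := fun h => hdown ⟨by omega, h⟩
          push_cast at hxy
          linarith
        obtain ⟨i, rfl⟩ : ∃ i', i = i' + 1 := ⟨i - 1, by omega⟩
        have hxhi : x ≤ hi := by
          rcases Nat.eq_zero_or_pos j with rfl | hj
          · have : 0 ≤ ((i + 1 : ℕ) : ℤ) * m := by positivity
            push_cast at hxy this
            linarith
          · by_contra hcon
            exact hdown ⟨hj, by omega⟩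
        refine ih i j (by omega) (x + m) (by omega) (by omega) ?_ (hadd x h1 hxhi hR)
        push_cast at hxy; linarith
  obtain ⟨c, hc⟩ := hdvd
  -- shift the Bézout coefficients by multiples of `(β, m)` to make both of the required sign
  set A := Int.gcdA m β * c
  set B := Int.gcdB m β * c
  have hAB : y - x = m * A + β * B := by
    rw [hc, Int.gcd_eq_gcd_ab]; ring
  set q : ℤ := |A| + |B| with hq
  have hqA : 0 ≤ A + q * β := by
    have : |A| ≤ q * β := (by have := abs_nonneg B; omega : |A| ≤ q).trans
      (le_mul_of_one_le_right (by positivity) hβ)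
    have := neg_abs_le A
    omega
  have hqB : 0 ≤ q * m - B := by
    have : |B| ≤ q * m := (by have := abs_nonneg A; omega : |B| ≤ q).trans
      (le_mul_of_one_le_right (by positivity) hm)
    have := le_abs_self B
    omega
  refine path _ (A + q * β).toNat (q * m - B).toNat rfl x (by omega) (by omega) ?_ hR
  rw [Int.toNat_of_nonneg hqA, Int.toNat_of_nonneg hqB]
  linear_combination hAB

/-! ### Transferring colours between solutions -/

/-- Arithmetic conditions on the equation `a x + b y = p(z)`: here `z` ranges over the class of `t`
modulo `d`, and `x`, `y` over the class of `v` modulo `u`. -/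
structure IsAdmissible (p : Polynomial ℤ) (a b d u t v : ℤ) : Prop where
  a_pos : 0 < a
  b_pos : 0 < b
  coprime : IsCoprime a b
  d_pos : 0 < d
  u_pos : 0 < u
  natDegree : 2 ≤ p.natDegree
  leadingCoeff : 0 < p.leadingCoeff
  dvd_fixed : d ∣ p.eval t - (a + b) * t
  increment : ∀ k, d ∣ k - t → ∃ m' : ℤ, p.eval (k + d) - p.eval k = a * (u * m') ∧
    Odd m' ∧ IsCoprime a m' ∧ IsCoprime b m'
  dvd_eval : ∀ k, d ∣ k - t → u ∣ p.eval k - (a + b) * v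
  dvd_solution : ∀ j k, u ∣ j - v → d ∣ k - t → b ∣ p.eval k - a * j

/-- No solution of `a x + b y = p(z)` in positive integers with `z > Z₀` is monochromatic. Colourings
are extended to all integers, with irrelevant values outside the positive ones. -/
def NoMonoSolution (p : Polynomial ℤ) (a b : ℤ) (χ : ℤ → Bool) (Z₀ : ℤ) : Prop :=
  ∀ x y z : ℤ, 0 < x → 0 < y → Z₀ < z → a * x + b * y = p.eval z → ¬ (χ x = χ z ∧ χ y = χ z)

section

variable {p : Polynomial ℤ} {a b d u t v : ℤ} {χ : ℤ → Bool} {Z₀ : ℤ}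

theorem IsAdmissible.dvd_eval_sub (H : IsAdmissible p a b d u t v) {k : ℤ} (hk : d ∣ k - t) (n : ℕ) :
    a * u ∣ p.eval k - p.eval (k - n * d) := by
  induction n with
  | zero => simp
  | succ n ih =>
    have hk' : d ∣ k - (n + 1 : ℕ) * d - t := by
      rw [sub_right_comm]
      exact dvd_sub hk (dvd_mul_left _ _)
    obtain ⟨m', hm', -⟩ := H.increment _ hk'
    have h1 : k - (n + 1 : ℕ) * d + d = k - n * d := by push_cast; ring
    rw [h1] at hm'
    have h2 : a * u ∣ p.eval (k - n * d) - p.eval (k - (n + 1 : ℕ) * d) :=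
      ⟨m', by rw [hm', mul_assoc]⟩
    simpa using dvd_add ih h2

/-- If `z` and `z'` have different colours, the common solution `y` of `a x + b y = p(z)` and
`a x' + b y = p(z')` carries the colour of `z` from `x` to `x'`. -/
theorem NoMonoSolution.transfer (hχ : NoMonoSolution p a b χ Z₀) (H : IsAdmissible p a b d u t v)
    {z z' x x' : ℤ} (hzt : d ∣ z - t) (hz : Z₀ < z) (hz' : Z₀ < z') (hzz : χ z' ≠ χ z)
    (hxv : u ∣ x - v) (hx0 : 0 < x) (hxz : a * x < p.eval z) (hx'0 : 0 < x')
    (hxx : a * x' = a * x + (p.eval z' - p.eval z)) (hx : χ x = χ z) : χ x' = χ z := by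
  obtain ⟨y, hy⟩ := H.dvd_solution x z hxv hzt
  have hy0 : 0 < y := by
    have : 0 < b * y := by omega
    exact pos_of_mul_pos_right this H.b_pos.le
  have h1 := hχ x y z hx0 hy0 hz (by omega)
  have h2 := hχ x' y z' hx'0 hy0 hz' (by omega)
  revert h1 h2 hzz hx
  cases χ x <;> cases χ y <;> cases χ z <;> cases χ z' <;> cases χ x' <;> simp

/-- If a set `A` of residue classes modulo the odd number `g` is such that every
`x = v + u i` near `p(z) / (a + b)` with `i ∈ A` has the colour of `z`, then `A` contains fewer than
half of the classes. Indeed the solutions of `a x + b y = p(z)` near the diagonal give an injection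
of `A` into its complement, and `g` is odd. -/
theorem NoMonoSolution.two_mul_card_lt (hχ : NoMonoSolution p a b χ Z₀)
    (H : IsAdmissible p a b d u t v) {z : ℤ} (hzt : d ∣ z - t) (hz : Z₀ < z) {g : ℕ} (hodd : Odd g)
    (hga : IsCoprime a (g : ℤ)) (hgb : IsCoprime b (g : ℤ)) (A : Finset (ZMod g))
    (hC : (a + b) * (a * b) * (u * g) < p.eval z)
    (hA : ∀ i : ℤ, p.eval z - (a + b) * (a * b) * (u * g) ≤ (a + b) * (v + u * i) →
      (a + b) * (v + u * i) ≤ p.eval z + (a + b) * (a * b) * (u * g) →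
      (i : ZMod g) ∈ A → χ (v + u * i) = χ z) :
    2 * A.card < g := by
  have hg : 0 < g := hodd.pos
  have : NeZero g := ⟨hg.ne'⟩
  obtain ⟨a0, b0, u0⟩ := And.intro H.a_pos (And.intro H.b_pos H.u_pos)
  have hab : 0 < a + b := by omega
  set P := p.eval z
  obtain ⟨e, he⟩ := H.dvd_eval z hzt
  -- a solution with both unknowns in the class of `v`, as close to the diagonal as possible
  obtain ⟨X, Y, hXY, hX0, hX1⟩ : ∃ X Y : ℤ, a * X + b * Y = e ∧
      0 ≤ (a + b) * (v + u * X) - P ∧ (a + b) * (v + u * X) - P < (a + b) * u * b := by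
    obtain ⟨r, s, hrs⟩ := H.coprime
    have hpos : 0 < (a + b) * u * b := by positivity
    set w := (a + b) * (v + u * (r * e)) - P with hw
    have h1 := Int.emod_add_mul_ediv w ((a + b) * u * b)
    have h2 := Int.emod_nonneg w hpos.ne'
    have h3 := Int.emod_lt_of_pos w hpos
    refine ⟨r * e - b * (w / ((a + b) * u * b)), s * e + a * (w / ((a + b) * u * b)), ?_, ?_, ?_⟩
    · linear_combination e * hrs
    · rw [show (a + b) * (v + u * (r * e - b * (w / ((a + b) * u * b)))) - P
        = w % ((a + b) * u * b) by linear_combination -h1]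
      exact h2
    · rw [show (a + b) * (v + u * (r * e - b * (w / ((a + b) * u * b)))) - P
        = w % ((a + b) * u * b) by linear_combination -h1]
      exact h3
  have hsol (s : ℤ) : a * (v + u * (X + b * s)) + b * (v + u * (Y - a * s)) = P := by
    linear_combination u * hXY - he
  have hbinv : (b : ZMod g) * (b : ZMod g)⁻¹ = 1 := ZMod.coe_int_mul_inv_eq_one hgb
  have hainv : (a : ZMod g) * (a : ZMod g)⁻¹ = 1 := ZMod.coe_int_mul_inv_eq_one hga
  set σ : ZMod g → ZMod g := fun α => (α - X) * (b : ZMod g)⁻¹ with hσ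
  set τ : ZMod g → ZMod g := fun α => Y - a * σ α with hτ
  have hτinj : Function.Injective τ := by
    intro α β hαβ
    simp only [hτ, hσ] at hαβ
    linear_combination (-(a : ZMod g)⁻¹ * b) * hαβ - (α - β) * (b * (b : ZMod g)⁻¹) * hainv
      - (α - β) * hbinv
  have hdisj : Disjoint (A.image τ) A := by
    rw [Finset.disjoint_left]
    intro β hβ hβA
    obtain ⟨α, hαA, rfl⟩ := Finset.mem_image.mp hβ
    set s : ℤ := ((σ α).val : ℤ) with hs
    have hs0 : 0 ≤ s := by positivity
    have hs1 : s + 1 ≤ g := by have := ZMod.val_lt (σ α); omega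
    have hsσ : (s : ZMod g) = σ α := by simp [hs]
    have hx : ((X + b * s : ℤ) : ZMod g) = α := by
      push_cast
      rw [hsσ, hσ]
      linear_combination (α - X) * hbinv
    have hy : ((Y - a * s : ℤ) : ZMod g) = τ α := by
      push_cast
      rw [hsσ]
    -- both unknowns stay in the window around the diagonal
    have hsb : (a + b) * u * b * s + (a + b) * u * b ≤ (a + b) * u * b * g := by
      rw [← mul_add_one]; exact mul_le_mul_of_nonneg_left hs1 (by positivity)
    have hs' : 0 ≤ (a + b) * u * b * s := by positivity
    have hCb : (a + b) * u * b * g ≤ (a + b) * (a * b) * (u * g) := by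
      have : 0 ≤ (a + b) * u * b * g := by positivity
      nlinarith
    have hCa : (a + b) * u * a * g ≤ (a + b) * (a * b) * (u * g) := by
      have : 0 ≤ (a + b) * u * a * g := by positivity
      nlinarith
    have hx1 : P ≤ (a + b) * (v + u * (X + b * s)) := by linarith
    have hx2 : (a + b) * (v + u * (X + b * s)) ≤ P + (a + b) * u * b * g := by linarith
    have hyx : b * ((a + b) * (v + u * (Y - a * s)))
        = (a + b) * P - a * ((a + b) * (v + u * (X + b * s))) := by
      linear_combination (a + b) * hsol s
    have hy1 : P - (a + b) * u * a * g ≤ (a + b) * (v + u * (Y - a * s)) := by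
      refine le_of_mul_le_mul_left ?_ b0
      rw [hyx]
      have := mul_le_mul_of_nonneg_left hx2 a0.le
      linarith
    have hy2 : (a + b) * (v + u * (Y - a * s)) ≤ P := by
      refine le_of_mul_le_mul_left ?_ b0
      rw [hyx]
      have := mul_le_mul_of_nonneg_left hx1 a0.le
      linarith
    have hcx := hA (X + b * s) (by linarith) (by linarith) (hx ▸ hαA)
    have hcy := hA (Y - a * s) (by linarith) (by linarith) (hy ▸ hβA)
    refine hχ _ _ z ?_ ?_ hz (hsol s) ⟨hcx, hcy⟩
    · exact pos_of_mul_pos_right (by linarith : 0 < (a + b) * (v + u * (X + b * s))) hab.le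
    · exact pos_of_mul_pos_right (by linarith : 0 < (a + b) * (v + u * (Y - a * s))) hab.le
  have h1 := Finset.card_le_univ (A.image τ ∪ A)
  rw [Finset.card_union_of_disjoint hdisj, Finset.card_image_of_injective _ hτinj, ZMod.card] at h1
  obtain ⟨c, rfl⟩ := hodd
  omega

/-- No colouring without large monochromatic solutions is eventually constant on the class of `t`
modulo `d`, so both kinds of colour changes occur there arbitrarily far out. -/
theorem NoMonoSolution.exists_switch (hχ : NoMonoSolution p a b χ Z₀)
    (H : IsAdmissible p a b d u t v) (c : Bool) (N : ℤ) :
    ∃ k, N ≤ k ∧ d ∣ k - t ∧ χ k = c ∧ χ (k + d) ≠ c := by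
  have a0 := H.a_pos
  have b0 := H.b_pos
  have d0 := H.d_pos
  -- a solution of the equation with all unknowns large and in the class of `t`
  have hnotconst (c : Bool) (N : ℤ) : ∃ k, N ≤ k ∧ d ∣ k - t ∧ χ k ≠ c := by
    by_contra! hcon
    set L : ℤ := |N| + |Z₀| + |t| + 1 with hL
    have hL0 : 0 < L := by positivity
    have hLN : N + |t| < L := by have := le_abs_self N; have := abs_nonneg Z₀; omega
    have hLZ : Z₀ + |t| < L := by have := le_abs_self Z₀; have := abs_nonneg N; omega
    have hLt : |t| < L := by have := abs_nonneg Z₀; have := abs_nonneg N; omega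
    have hdL : L ≤ d * L := le_mul_of_one_le_left hL0.le (by omega)
    obtain ⟨N₂, hN₂, hbig⟩ := exists_pow_natDegree_le_two_mul_eval p H.leadingCoeff
    set n : ℤ := N₂ + L + 2 * ((a + b) * |t| + d * (a * (L + b) + b * L)) with hn
    have hpos1 : 0 < (a + b) * |t| + d * (a * (L + b) + b * L) := by positivity
    have hnn : n ≤ d * n := le_mul_of_one_le_left (by omega) (by omega)
    set z := t + d * n with hz
    have htabs := neg_abs_le t
    have hzn : n - |t| ≤ z := by omega
    have hzp := hbig z (by omega)
    have hz0 : 1 ≤ z := by omega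
    have hzz : z ≤ z ^ p.natDegree := le_self_pow₀ hz0 (by have := H.natDegree; omega)
    obtain ⟨W, hW⟩ : d ∣ p.eval z - (a + b) * t := by
      have h1 : z - t ∣ p.eval z - p.eval t := Polynomial.sub_dvd_eval_sub z t p
      have h2 : d ∣ z - t := ⟨n, by rw [hz]; ring⟩
      have := dvd_add (h2.trans h1) H.dvd_fixed
      rwa [sub_add_sub_cancel] at this
    obtain ⟨r, s, hrs⟩ := H.coprime
    have hm1 := Int.emod_add_mul_ediv (r * W - L) b
    have hm2 := Int.emod_nonneg (r * W - L) b0.ne'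
    have hm3 := Int.emod_lt_of_pos (r * W - L) b0
    set X := L + (r * W - L) % b with hX
    set Y := s * W + a * ((r * W - L) / b) with hY
    have hXY : a * X + b * Y = W := by
      rw [hX, hY]
      linear_combination W * hrs + a * hm1
    have hXL : L ≤ X := by omega
    have hYL : L ≤ Y := by
      have h1 : (a + b) * t ≤ (a + b) * |t| :=
        mul_le_mul_of_nonneg_left (le_abs_self t) (by omega)
      have h2 : d * (a * (L + b) + b * L) ≤ d * W := by rw [← hW]; omega
      have h3 : a * (L + b) + b * L ≤ W := le_of_mul_le_mul_left h2 d0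
      have h4 : a * X ≤ a * (L + b) := mul_le_mul_of_nonneg_left (by omega) a0.le
      exact le_of_mul_le_mul_left (by omega : b * L ≤ b * Y) b0
    have hdX : d * L ≤ d * X := mul_le_mul_of_nonneg_left hXL d0.le
    have hdY : d * L ≤ d * Y := mul_le_mul_of_nonneg_left hYL d0.le
    have hcx := hcon (t + d * X) (by omega) (by simp)
    have hcy := hcon (t + d * Y) (by omega) (by simp)
    have hcz := hcon z (by omega) (by simp [hz])
    refine hχ (t + d * X) (t + d * Y) z (by omega) (by omega) (by omega) ?_
      ⟨hcx.trans hcz.symm, hcy.trans hcz.symm⟩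
    linear_combination d * hXY - hW
  obtain ⟨k₀, hk₀, hkt, hkc⟩ := hnotconst (!c) N
  by_contra! hcon
  have hall (n : ℕ) : χ (k₀ + n * d) = c := by
    induction n with
    | zero => simpa using hkc
    | succ n ih =>
      have hnd : 0 ≤ (n : ℤ) * d := by positivity
      have := hcon (k₀ + n * d) (by omega)
        (by rw [add_sub_right_comm]; exact dvd_add hkt (dvd_mul_left _ _)) ih
      rw [← this]
      congr 1
      push_cast
      ring
  obtain ⟨k, hk, hkt', hkc'⟩ := hnotconst c k₀
  obtain ⟨e, he⟩ : d ∣ k - k₀ := by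
    have := dvd_sub hkt' hkt
    rwa [sub_sub_sub_cancel_right] at this
  have he0 : 0 ≤ e := by
    have : 0 ≤ d * e := by omega
    exact nonneg_of_mul_nonneg_right this d0
  lift e to ℕ using he0
  exact hkc' (by rw [← hall e]; congr 1; linarith)

end

theorem odd_of_dvd {m : ℤ} {g : ℕ} (hm : Odd m) (hg : (g : ℤ) ∣ m) : Odd g := by
  rw [← Int.odd_coe_nat]
  obtain ⟨e, rfl⟩ := hg
  exact (Int.odd_mul.mp hm).1

/-- Bounds for `p` along an arithmetic progression below `k` on which its increments lie in
`(0, M]`. -/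
theorem eval_sub_mul_bounds {p : Polynomial ℤ} {d k M L : ℤ} (hd : 0 < d)
    (hinc : ∀ w, k - L ≤ w → w ≤ k →
      0 < p.eval (w + d) - p.eval w ∧ p.eval (w + d) - p.eval w ≤ M) (i : ℕ) (hi : i * d ≤ L) :
    p.eval k - i * M ≤ p.eval (k - i * d) ∧ p.eval (k - i * d) ≤ p.eval k ∧
      (i ≠ 0 → p.eval (k - i * d) < p.eval k) := by
  induction i with
  | zero => simp
  | succ i ih =>
    have hid0 : 0 ≤ ((i + 1 : ℕ) : ℤ) * d := by positivity
    obtain ⟨h1, h2, -⟩ := ih (by push_cast at hi; linarith)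
    obtain ⟨h3, h4⟩ := hinc (k - (i + 1 : ℕ) * d) (by omega) (by omega)
    rw [show k - ((i + 1 : ℕ) : ℤ) * d + d = k - i * d by push_cast; ring] at h3 h4
    push_cast at h3 h4 ⊢
    exact ⟨by linarith, by linarith, fun _ => by linarith⟩

section

variable {p : Polynomial ℤ} {a b d u t v : ℤ} {χ : ℤ → Bool} {Z₀ : ℤ}

/-! ### Two opposite colour changes at comparable places -/

/-- If `k` differs in colour both from `k + d` and from a nearby smaller `w`, the colour of `k` is
stable on the class of `v` under a forward and a backward step, so near `p(k) / (a + b)` the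
colouring is periodic with odd period (in units of `u`). Then each of the two colours would
occupy fewer than half of the residue classes. -/
theorem NoMonoSolution.not_near_switch (hχ : NoMonoSolution p a b χ Z₀)
    (H : IsAdmissible p a b d u t v) {k M L : ℤ} {n : ℕ} (hkt : d ∣ k - t) (hk : Z₀ < k)
    (hkd : χ (k + d) ≠ χ k) (hw : Z₀ < k - n * d) (hwc : χ (k - n * d) ≠ χ k)
    (hinc : 0 < p.eval (k + d) - p.eval k) (hincM : p.eval (k + d) - p.eval k ≤ M)
    (hdec : 0 < p.eval k - p.eval (k - n * d)) (hdecL : p.eval k - p.eval (k - n * d) ≤ L)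
    (hP : a * ((a + b) * (a * b) * M + M + (a + b) * (1 + M + L)) < p.eval k) : False := by
  classical
  obtain ⟨a0, b0, u0, d0⟩ := And.intro H.a_pos (And.intro H.b_pos (And.intro H.u_pos H.d_pos))
  have hab : 0 < a + b := by omega
  obtain ⟨m', hm', hodd, ham', hbm'⟩ := H.increment k hkt
  obtain ⟨β', hβ'⟩ := H.dvd_eval_sub hkt n
  set P := p.eval k
  have hm : 0 < u * m' := pos_of_mul_pos_right (hm' ▸ hinc) a0.le
  have hmM : u * m' ≤ M := (le_mul_of_one_le_left hm.le a0).trans (hm' ▸ hincM)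
  have hβ : 0 < u * β' := by
    rw [mul_assoc] at hβ'
    exact pos_of_mul_pos_right (hβ' ▸ hdec) a0.le
  have hβL : u * β' ≤ L := by
    rw [mul_assoc] at hβ'
    exact (le_mul_of_one_le_left hβ.le a0).trans (hβ' ▸ hdecL)
  set g := Int.gcd m' β' with hg
  have hgm : (g : ℤ) ∣ m' := Int.gcd_dvd_left ..
  have hgodd : Odd g := odd_of_dvd hodd hgm
  have hga : IsCoprime a (g : ℤ) := ham'.of_isCoprime_of_dvd_right hgm
  have hgb : IsCoprime b (g : ℤ) := hbm'.of_isCoprime_of_dvd_right hgm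
  have hug : u * g ≤ M := (Int.le_of_dvd hm (mul_dvd_mul_left u hgm)).trans hmM
  have hgcd : (Int.gcd (u * m') (u * β') : ℤ) = u * g := by
    rw [Int.gcd_mul_left]; push_cast; rw [abs_of_pos u0]
  set C := (a + b) * (a * b) * M with hC
  have hCg : (a + b) * (a * b) * (u * g) ≤ C := mul_le_mul_of_nonneg_left hug (by positivity)
  have hM0 : 0 < M := hm.trans_le hmM
  have hL0 : 0 < L := hβ.trans_le hβL
  have hC0 : 0 < C := by positivity
  have hP0 : 0 < C + M + (a + b) * (1 + M + L) := by positivity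
  have hP1 : C + M + (a + b) * (1 + M + L) < P := (le_mul_of_one_le_left hP0.le a0).trans_lt hP
  set lo := (P - C - M) / (a + b) with hlo
  set hi := (P + C + M) / (a + b) with hhi
  have hlo1 : u * β' < lo := by
    rw [hlo, ← Int.add_one_le_iff, Int.le_ediv_iff_mul_le hab]
    have : (u * β' + 1) * (a + b) ≤ (L + 1) * (a + b) :=
      mul_le_mul_of_nonneg_right (by omega) hab.le
    have : 0 < (a + b) * M := by positivity
    linarith
  have hhi1 : a * (hi + u * m') < P := by
    have h1 : (a + b) * hi ≤ P + C + M := Int.mul_ediv_self_le hab.ne'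
    have h2 : (a + b) * (u * m') ≤ (a + b) * M := mul_le_mul_of_nonneg_left hmM hab.le
    have h3 : a * ((a + b) * (hi + u * m')) ≤ a * (P + C + M + (a + b) * M) :=
      mul_le_mul_of_nonneg_left (by linarith) a0.le
    have h4 : 0 < a * ((a + b) * (1 + L)) := by positivity
    have h5 : P ≤ b * P := le_mul_of_one_le_left (by omega) b0
    refine lt_of_mul_lt_mul_left ?_ hab.le
    linarith
  have hwin {i : ℤ} (h1 : P - C - M ≤ (a + b) * (v + u * i))
      (h2 : (a + b) * (v + u * i) ≤ P + C + M) : lo ≤ v + u * i ∧ v + u * i ≤ hi := by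
    constructor
    · rw [hlo]
      have := Int.ediv_le_ediv hab h1
      rwa [Int.mul_ediv_cancel_left _ hab.ne'] at this
    · rw [hhi, Int.le_ediv_iff_mul_le hab]
      linarith
  have hper {i j : ℤ} (hi1 : lo ≤ v + u * i) (hi2 : v + u * i ≤ hi) (hj1 : lo ≤ v + u * j)
      (hj2 : v + u * j ≤ hi) (hij : (i : ZMod g) = j) (hc : χ (v + u * i) = χ k) :
      χ (v + u * j) = χ k := by
    refine (pred_of_gcd_dvd (R := fun x => u ∣ x - v ∧ χ x = χ k) (lo := lo) (hi := hi) hm hβ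
      ?_ ?_ hi1 hi2 hj1 hj2 ?_ ⟨by simp, hc⟩).2
    · rintro x hx1 hx2 ⟨hxv, hx⟩
      have hax : a * x ≤ a * hi := mul_le_mul_of_nonneg_left hx2 a0.le
      have ham : 0 < a * (u * m') := by positivity
      refine ⟨by rw [add_sub_right_comm]; exact dvd_add hxv (dvd_mul_right _ _),
        hχ.transfer H hkt hk (by omega) hkd hxv (by omega) (by linarith) (by omega) ?_ hx⟩
      rw [hm']; ring
    · rintro x hx1 hx2 ⟨hxv, hx⟩
      have hax : a * x ≤ a * (hi + u * m') := mul_le_mul_of_nonneg_left hx2 a0.le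
      refine ⟨by rw [sub_right_comm]; exact dvd_sub hxv (dvd_mul_right _ _),
        hχ.transfer H hkt hk hw hwc hxv (by omega) (by linarith) (by omega) ?_ hx⟩
      linear_combination hβ'
    · rw [hgcd, add_sub_add_left_eq_sub, ← mul_sub]
      exact mul_dvd_mul_left u ((ZMod.intCast_eq_intCast_iff_dvd_sub _ _ _).mp hij)
  have : NeZero g := ⟨hgodd.pos.ne'⟩
  set A : Finset (ZMod g) := Finset.univ.filter fun α =>
    ∃ i : ℤ, (i : ZMod g) = α ∧ lo ≤ v + u * i ∧ v + u * i ≤ hi ∧ χ (v + u * i) = χ k with hA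
  have hb1 : 0 < (a + b) * (1 + M + L) := by positivity
  have h1 : 2 * A.card < g := by
    refine hχ.two_mul_card_lt H hkt hk hgodd hga hgb A (by linarith) fun j hj1 hj2 hj => ?_
    obtain ⟨i, hij, hi1, hi2, hc⟩ := (Finset.mem_filter.mp hj).2
    obtain ⟨hj3, hj4⟩ := hwin (i := j) (by linarith) (by linarith)
    exact hper hi1 hi2 hj3 hj4 hij hc
  have h2 : 2 * Aᶜ.card < g := by
    have hkt' : d ∣ k + d - t := by
      rw [add_sub_right_comm]; exact dvd_add hkt dvd_rfl
    refine hχ.two_mul_card_lt H hkt' (by omega) hgodd hga hgb Aᶜ (by linarith)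
      fun j hj1 hj2 hj => ?_
    obtain ⟨hj3, hj4⟩ := hwin (i := j) (by linarith) (by linarith)
    have hne : χ (v + u * j) ≠ χ k := fun hc => by
      rw [Finset.mem_compl] at hj
      exact hj (Finset.mem_filter.mpr ⟨Finset.mem_univ _, j, rfl, hj3, hj4, hc⟩)
    revert hne hkd
    cases χ (v + u * j) <;> cases χ k <;> cases χ (k + d) <;> simp
  have h3 := Finset.card_add_card_compl A
  rw [ZMod.card] at h3
  omega

/-! ### A colour change after a long monochromatic run -/

/-- After a run of one colour followed by a change, that colour is stable under all sums of steps
from the run, as long as `y` stays positive; this is what the bound `Q` ensures. -/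
theorem NoMonoSolution.add_mem_closure (hχ : NoMonoSolution p a b χ Z₀)
    (H : IsAdmissible p a b d u t v) {k : ℤ} {n : ℕ} {α : ℕ → ℤ} {Q : ℤ} (hkt : d ∣ k - t)
    (hn : Z₀ < k - n * d) (hrun : ∀ i : ℕ, i ≤ n → χ (k - i * d) = χ k) (hkd : χ (k + d) ≠ χ k)
    (hα : ∀ i : ℕ, a * α i = p.eval (k + d) - p.eval (k - i * d)) (hαu : ∀ i, u ∣ α i)
    (hpos : ∀ i ≤ n, 0 < α i) (hQ : ∀ i : ℕ, i ≤ n → Q ≤ p.eval (k - i * d)) {σ : ℤ}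
    (hσ : σ ∈ AddSubmonoid.closure (α '' {i | i ≤ n})) :
    0 ≤ σ ∧ u ∣ σ ∧ ∀ x, u ∣ x - v → 0 < x → χ x = χ k → a * (x + σ) ≤ Q → χ (x + σ) = χ k := by
  have a0 := H.a_pos
  have d0 := H.d_pos
  induction hσ using AddSubmonoid.closure_induction with
  | mem σ hσ =>
    obtain ⟨i, hi, rfl⟩ := hσ
    have hi' : i ≤ n := hi
    have hin : (i : ℤ) * d ≤ n * d := mul_le_mul_of_nonneg_right (by exact_mod_cast hi') d0.le
    have hnd : 0 ≤ (i : ℤ) * d := by positivity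
    have hαi := hpos i hi'
    refine ⟨hαi.le, hαu i, fun x hxv hx0 hx hxQ => ?_⟩
    have haα : 0 < a * α i := by positivity
    rw [← hrun i hi'] at hx hkd ⊢
    refine hχ.transfer H (z := k - i * d) (z' := k + d) ?_ (by omega) (by omega) hkd hxv hx0 ?_
      (by omega) ?_ hx
    · rw [sub_right_comm]; exact dvd_sub hkt (dvd_mul_left _ _)
    · have := hQ i hi'
      linarith
    · rw [← hα]; ring
  | zero => exact ⟨le_rfl, dvd_zero _, fun x _ _ hx _ => by simpa using hx⟩
  | add σ τ _ _ h1 h2 =>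
    obtain ⟨hσ0, hσu, hσ⟩ := h1
    obtain ⟨hτ0, hτu, hτ⟩ := h2
    refine ⟨by omega, dvd_add hσu hτu, fun x hxv hx0 hx hxQ => ?_⟩
    rw [← add_assoc] at hxQ ⊢
    have haτ : 0 ≤ a * τ := by positivity
    refine hτ _ ?_ (by omega) (hσ x hxv hx0 hx (by linarith)) hxQ
    rw [add_sub_right_comm]; exact dvd_add hxv hσu

open Polynomial in
/-- The `D`-th difference of `p` with step `d`, where `D = deg p`, is a multiple of `a u`. -/
theorem IsAdmissible.exists_top_difference (H : IsAdmissible p a b d u t v) :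
    ∃ n : ℕ, 0 < n ∧
      (p.natDegree.factorial : ℤ) * p.leadingCoeff * d ^ p.natDegree = a * (u * n) := by
  have hD : p.natDegree ≠ 0 := by have := H.natDegree; omega
  obtain ⟨a0, u0, d0, l0⟩ :=
    And.intro H.a_pos (And.intro H.u_pos (And.intro H.d_pos H.leadingCoeff))
  have hdvd : a * u ∣ (p.natDegree.factorial : ℤ) * p.leadingCoeff * d ^ p.natDegree := by
    have hz : ∑ i ∈ Finset.range (p.natDegree + 1),
        (-1) ^ i * (p.natDegree.choose i : ℤ) * p.eval t = 0 := by
      rw [← Finset.sum_mul, Int.alternating_sum_range_choose_of_ne hD, zero_mul]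
    rw [← alternating_sum_eval p t d0.ne', ← dvd_neg, neg_eq_zero_sub, ← hz,
      ← Finset.sum_sub_distrib]
    refine Finset.dvd_sum fun i _ => ?_
    rw [← mul_sub]
    exact (H.dvd_eval_sub (by simp) i).mul_left _
  obtain ⟨n, hn⟩ := hdvd
  have hpos : 0 < (p.natDegree.factorial : ℤ) * p.leadingCoeff * d ^ p.natDegree := by positivity
  have hn0 : 0 < n := pos_of_mul_pos_right (hn ▸ hpos) (by positivity)
  lift n to ℕ using hn0.le
  exact ⟨n, by exact_mod_cast hn0, by rw [hn, mul_assoc]⟩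

/-- The positive representative `≡ v (mod u)` of the class `α` modulo `g` that is used to compare
the colours of residue classes: `v + u i` with `i ≡ α (mod g)`. -/
def lowRepresentative (u v : ℤ) {g : ℕ} (α : ZMod g) : ℤ :=
  v + u * (g * (|v| + 1) + (α.val : ℤ))

theorem lowRepresentative_pos (hu : 0 < u) {g : ℕ} [NeZero g] (α : ZMod g) :
    0 < lowRepresentative u v α := by
  have hg : (1 : ℤ) ≤ g := by exact_mod_cast (NeZero.pos g)
  have h1 : |v| + 1 ≤ g * (|v| + 1) := le_mul_of_one_le_left (by positivity) hg
  have h2 : (0 : ℤ) ≤ (α.val : ℤ) := by positivity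
  have h3 : g * (|v| + 1) + (α.val : ℤ) ≤ u * (g * (|v| + 1) + (α.val : ℤ)) :=
    le_mul_of_one_le_left (by positivity) hu
  have := neg_abs_le v
  rw [lowRepresentative]
  omega

theorem lowRepresentative_le (hu : 0 < u) {g : ℕ} [NeZero g] (α : ZMod g) :
    lowRepresentative u v α ≤ |v| + u * g * (|v| + 2) := by
  have h1 : (α.val : ℤ) ≤ g := by exact_mod_cast (ZMod.val_lt α).le
  have h2 : u * (α.val : ℤ) ≤ u * g := mul_le_mul_of_nonneg_left h1 hu.le
  have := le_abs_self v
  rw [lowRepresentative]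
  linarith

/-- After a long run of one colour, that colour is rare: among fixed representatives of the classes
modulo a suitable odd `g`, fewer than half have it. The run makes the colour stable under a
submonoid of steps that contains all large multiples of `u g`, so that a single low element of a
class forces the colour on the whole class near `p(k) / (a + b)`. -/
theorem NoMonoSolution.two_mul_card_low_lt (hχ : NoMonoSolution p a b χ Z₀)
    (H : IsAdmissible p a b d u t v) {n : ℕ} (hn0 : 0 < n)
    (hn : (p.natDegree.factorial : ℤ) * p.leadingCoeff * d ^ p.natDegree = a * (u * n))
    {k M m' : ℤ} {s : ℕ} (hkt : d ∣ k - t) (hk : Z₀ < k - p.natDegree * 2 ^ s * d)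
    (hkd : χ (k + d) ≠ χ k) (hm' : p.eval (k + d) - p.eval k = a * (u * m'))
    (hrun : ∀ i : ℕ, i ≤ p.natDegree * 2 ^ s → χ (k - i * d) = χ k)
    (hM0 : 0 < M) (hMs : M ≤ 2 ^ (p.natDegree * s))
    (hinc : ∀ w, k - p.natDegree * 2 ^ s * d ≤ w → w ≤ k →
      0 < p.eval (w + d) - p.eval w ∧ p.eval (w + d) - p.eval w ≤ M)
    (hP : a * ((a + b) * (a * b) * (u * n)) + (a + b) * (|v| + u * n * (|v| + 2) + u * n * M +
      4 ^ p.natDegree * (u * n) * (p.natDegree + 1) * (2 ^ s * M) + p.natDegree * (2 ^ s * M))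
        < p.eval k)
    {g : ℕ} (hgodd : Odd g) (hga : IsCoprime a (g : ℤ)) (hgb : IsCoprime b (g : ℤ)) (hgn : g ∣ n)
    (hgcd : (Int.gcd n m' : ℤ) ∣ g) :
    2 * Nat.card {α : ZMod g // χ (lowRepresentative u v α) = χ k} < g := by
  classical
  obtain ⟨a0, b0, u0, d0⟩ := And.intro H.a_pos (And.intro H.b_pos (And.intro H.u_pos H.d_pos))
  have hab : 0 < a + b := by omega
  have : NeZero g := ⟨hgodd.pos.ne'⟩
  set D := p.natDegree with hD
  set P := p.eval k
  have hG : 0 < u * n := by positivity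
  have hhM : 0 < 2 ^ s * M := by positivity
  -- the values of `p` along the run
  have hvals : ∀ i : ℕ, i ≤ D * 2 ^ s →
      P - i * M ≤ p.eval (k - i * d) ∧ p.eval (k - i * d) ≤ P := fun i hi => by
    obtain ⟨h1, h2, -⟩ := eval_sub_mul_bounds d0 hinc i
      (mul_le_mul_of_nonneg_right (by exact_mod_cast hi) d0.le)
    exact ⟨h1, h2⟩
  obtain ⟨hk1, hk2⟩ := hinc k (by have : 0 ≤ (D : ℤ) * 2 ^ s * d := by positivity
                                  omega) le_rfl
  have hkt' : d ∣ k + d - t := by rw [add_sub_right_comm]; exact dvd_add hkt dvd_rfl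
  have hαex : ∀ i : ℕ, ∃ α : ℤ, a * α = p.eval (k + d) - p.eval (k - i * d) ∧ u ∣ α := by
    intro i
    obtain ⟨e, he⟩ := H.dvd_eval_sub hkt' (i + 1)
    refine ⟨u * e, ?_, dvd_mul_right _ _⟩
    rw [show k - (i : ℤ) * d = k + d - (i + 1 : ℕ) * d by push_cast; ring, he]
    ring
  choose α hα hαu using hαex
  have hα0 : α 0 = u * m' := by
    have h := hα 0
    simp only [Nat.cast_zero, zero_mul, sub_zero] at h
    exact mul_left_cancel₀ a0.ne' (h.trans hm')
  have hpos : ∀ i ≤ D * 2 ^ s, 0 < α i := fun i hi => by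
    have h1 := (hvals i hi).2
    exact pos_of_mul_pos_right (by rw [hα]; linarith) a0.le
  have hle : ∀ i ≤ D * 2 ^ s, α i ≤ (i + 1) * M := fun i hi => by
    have h1 := (hvals i hi).1
    refine (le_mul_of_one_le_left (hpos i hi).le a0).trans ?_
    rw [hα]; linarith
  have hdiff : ∀ h : ℕ, 1 ≤ h →
      ∑ i ∈ Finset.range (D + 1), (-1) ^ i * (D.choose i : ℤ) * α (i * h) = -(u * n * h ^ D) := by
    intro h hh
    refine mul_left_cancel₀ a0.ne' ?_
    have hh0 : (h : ℤ) * d ≠ 0 := by positivity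
    have h1 := alternating_sum_eval p k hh0
    have h2 : ∑ i ∈ Finset.range (D + 1), (-1) ^ i * (D.choose i : ℤ) * p.eval (k + d) = 0 := by
      rw [← Finset.sum_mul, Int.alternating_sum_range_choose_of_ne
        (by have := H.natDegree; omega), zero_mul]
    calc a * ∑ i ∈ Finset.range (D + 1), (-1) ^ i * (D.choose i : ℤ) * α (i * h)
        = ∑ i ∈ Finset.range (D + 1), ((-1) ^ i * (D.choose i : ℤ) * p.eval (k + d)
            - (-1) ^ i * (D.choose i : ℤ) * p.eval (k - i * (h * d))) := by
          rw [Finset.mul_sum]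
          refine Finset.sum_congr rfl fun i _ => ?_
          rw [← mul_sub, ← mul_assoc (i : ℤ), ← Nat.cast_mul, ← hα]
          ring
      _ = a * -(u * n * h ^ D) := by
          rw [Finset.sum_sub_distrib, h2, h1, mul_pow]
          linear_combination -((h : ℤ) ^ D) * hn
  have hDs : ((D * 2 ^ s : ℕ) : ℤ) = D * 2 ^ s := by push_cast; rfl
  have hug : u * g ≤ u * n := mul_le_mul_of_nonneg_left
    (by exact_mod_cast Nat.le_of_dvd hn0 hgn) u0.le
  set C := (a + b) * (a * b) * (u * n) with hC
  have hC0 : 0 < C := by positivity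
  have hCg : (a + b) * (a * b) * (u * g) ≤ C := mul_le_mul_of_nonneg_left hug (by positivity)
  have haC : C ≤ a * C := le_mul_of_one_le_left hC0.le a0
  have hrest : 0 ≤ (a + b) * (|v| + u * n * (|v| + 2) + u * n * M +
      4 ^ D * (u * n) * (D + 1) * (2 ^ s * M) + D * (2 ^ s * M)) := by positivity
  have hZk : Z₀ < k := by
    have : 0 ≤ (D : ℤ) * 2 ^ s * d := by positivity
    omega
  rw [Nat.card_eq_fintype_card, Fintype.card_subtype]
  refine hχ.two_mul_card_lt H hkt hZk hgodd hga hgb _ (by linarith) fun i hi1 hi2 hi => ?_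
  set x := lowRepresentative u v (i : ZMod g) with hx
  have hxc : χ x = χ k := (Finset.mem_filter.mp hi).2
  have hx0 : 0 < x := lowRepresentative_pos u0 _
  have hxle : x ≤ |v| + u * n * (|v| + 2) := (lowRepresentative_le u0 _).trans
    (by have := mul_le_mul_of_nonneg_right hug (by positivity : 0 ≤ |v| + 2); linarith)
  set y := v + u * i with hy
  have hxv : u ∣ x - v := by rw [hx, lowRepresentative, add_sub_cancel_left]; exact dvd_mul_right _ _
  have hyx : u * (g : ℤ) ∣ y - x := by
    rw [hx, hy, lowRepresentative, add_sub_add_left_eq_sub, ← mul_sub]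
    refine mul_dvd_mul_left u ((ZMod.intCast_eq_intCast_iff_dvd_sub _ _ _).mp ?_)
    simp
  have hmem : y - x ∈ AddSubmonoid.closure (α '' {i | i ≤ D * 2 ^ s}) := by
    refine mem_closure_of_gcd_dvd hG hM0 hdiff hpos hle le_rfl hMs ?_ ?_
    · rw [hα0, Int.gcd_mul_left]
      push_cast
      rw [abs_of_pos u0]
      exact (mul_dvd_mul_left u hgcd).trans hyx
    · refine le_of_mul_le_mul_left ?_ hab
      have h1 : (a + b) * x ≤ (a + b) * (|v| + u * n * (|v| + 2)) :=
        mul_le_mul_of_nonneg_left hxle hab.le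
      have h2 : 0 ≤ (a + b) * (D * (2 ^ s * M)) := by positivity
      rw [mul_sub]
      linarith
  have hQ : ∀ i : ℕ, i ≤ D * 2 ^ s → P - D * (2 ^ s * M) ≤ p.eval (k - i * d) := fun i hi => by
    have h1 := (hvals i hi).1
    have h2 : (i : ℤ) * M ≤ D * 2 ^ s * M := mul_le_mul_of_nonneg_right (by exact_mod_cast hi) hM0.le
    linarith
  have h := (hχ.add_mem_closure H hkt (by rw [hDs]; exact hk) hrun hkd hα hαu hpos hQ hmem).2.2
    x hxv hx0 hxc ?_
  · rwa [add_sub_cancel] at h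
  · rw [add_sub_cancel]
    refine le_of_mul_le_mul_left ?_ hab
    have h1 : a * ((a + b) * y) ≤ a * (P + C) := mul_le_mul_of_nonneg_left (by linarith) a0.le
    have h2 : P ≤ b * P := le_mul_of_one_le_left (by linarith) b0
    have h3 : 0 ≤ (a + b) * (|v| + u * n * (|v| + 2) + u * n * M +
      4 ^ D * (u * n) * (D + 1) * (2 ^ s * M)) := by positivity
    linarith

/-! ### Conclusion -/

/-- Every colour change far out determines a divisor `g₀` of `n` such that, for all suitable odd
multiples `g` of `g₀`, the colour before the change is rare among low classes modulo `g`. -/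
theorem NoMonoSolution.exists_modulus (hχ : NoMonoSolution p a b χ Z₀)
    (H : IsAdmissible p a b d u t v) {n : ℕ} (hn0 : 0 < n)
    (hn : (p.natDegree.factorial : ℤ) * p.leadingCoeff * d ^ p.natDegree = a * (u * n)) :
    ∃ N : ℤ, ∀ k, N ≤ k → d ∣ k - t → χ (k + d) ≠ χ k →
      ∃ g₀ : ℕ, Odd g₀ ∧ IsCoprime a (g₀ : ℤ) ∧ IsCoprime b (g₀ : ℤ) ∧ g₀ ∣ n ∧
        ∀ g : ℕ, Odd g → IsCoprime a (g : ℤ) → IsCoprime b (g : ℤ) → g ∣ n → g₀ ∣ g →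
          2 * Nat.card {α : ZMod g // χ (lowRepresentative u v α) = χ k} < g := by
  obtain ⟨a0, b0, u0, d0⟩ := And.intro H.a_pos (And.intro H.b_pos (And.intro H.u_pos H.d_pos))
  have hab : 0 < a + b := by omega
  set D := p.natDegree with hD
  set K₁ : ℤ := a * ((a + b) * (a * b) + 1 + (a + b) * (2 + D)) with hK₁
  set K₂ : ℤ := a * ((a + b) * (a * b) * (u * n)) + (a + b) * (|v| + u * n * (|v| + 2) + u * n +
    4 ^ D * (u * n) * (D + 1) + D) with hK₂
  have hK₁0 : 0 < K₁ := by positivity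
  have hK₂0 : 0 < K₂ := by positivity
  obtain ⟨N, -, hN⟩ := exists_dyadic_scale p H.natDegree H.leadingCoeff d0 (K₁ + K₂ + |Z₀| + 1)
  refine ⟨N, fun k hk hkt hkd => ?_⟩
  obtain ⟨s, M, -, hM0, hMs, hKP, hKk, hinc⟩ := hN k hk
  rw [← hD] at hMs hKk hinc
  have hh : (1 : ℤ) ≤ 2 ^ s := one_le_pow₀ (by norm_num)
  have hMh : M ≤ 2 ^ s * M := le_mul_of_one_le_left hM0.le hh
  have h1h : 1 ≤ 2 ^ s * M := by omega
  have hZ := le_abs_self Z₀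
  have hZ0 := abs_nonneg Z₀
  have hZk : Z₀ < k - D * 2 ^ s * d := by omega
  have hDs0 : 0 ≤ (D : ℤ) * 2 ^ s * d := by positivity
  have hK₁P : K₁ * (2 ^ s * M) < p.eval k := by
    have : 0 < (K₂ + |Z₀| + 1) * (2 ^ s * M) := by positivity
    linarith
  have hK₂P : K₂ * (2 ^ s * M) < p.eval k := by
    have : 0 < (K₁ + |Z₀| + 1) * (2 ^ s * M) := by positivity
    linarith
  obtain ⟨m', hm', hodd, ham', hbm'⟩ := H.increment k hkt
  obtain ⟨hk1, hk2⟩ := hinc k (by omega) le_rfl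
  have hrun : ∀ i : ℕ, i ≤ D * 2 ^ s → χ (k - i * d) = χ k := by
    intro i hi
    by_contra hne
    have hi0 : i ≠ 0 := by rintro rfl; simp at hne
    have hiD : (i : ℤ) ≤ D * 2 ^ s := by exact_mod_cast hi
    have hid : (i : ℤ) * d ≤ D * 2 ^ s * d := mul_le_mul_of_nonneg_right hiD d0.le
    have hiM : (i : ℤ) * M ≤ D * 2 ^ s * M := mul_le_mul_of_nonneg_right hiD hM0.le
    obtain ⟨h1, -, h2⟩ := eval_sub_mul_bounds d0 hinc i hid
    refine hχ.not_near_switch H (L := D * 2 ^ s * M) hkt (by omega) hkd (by omega) hne hk1 hk2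
      (by have := h2 hi0; omega) (by omega) (lt_of_le_of_lt ?_ hK₁P)
    rw [hK₁, mul_assoc a]
    refine mul_le_mul_of_nonneg_left ?_ a0.le
    have e1 : (a + b) * (a * b) * M ≤ (a + b) * (a * b) * (2 ^ s * M) :=
      mul_le_mul_of_nonneg_left hMh (by positivity)
    have e2 : (a + b) * (1 + M) ≤ (a + b) * (2 * (2 ^ s * M)) :=
      mul_le_mul_of_nonneg_left (by linarith) hab.le
    linarith
  have hgm : (Int.gcd n m' : ℤ) ∣ m' := Int.gcd_dvd_right ..
  refine ⟨Int.gcd n m', odd_of_dvd hodd hgm, ham'.of_isCoprime_of_dvd_right hgm,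
    hbm'.of_isCoprime_of_dvd_right hgm, Int.natCast_dvd_natCast.mp (Int.gcd_dvd_left ..), ?_⟩
  intro g hgodd hga hgb hgn hg₀
  refine hχ.two_mul_card_low_lt H hn0 hn hkt hZk hkd hm' hrun hM0 hMs hinc
    (lt_of_le_of_lt ?_ hK₂P) hgodd hga hgb hgn (Int.natCast_dvd_natCast.mpr hg₀)
  rw [hK₂, ← hD]
  have e1 : a * ((a + b) * (a * b) * (u * n)) * 1 ≤
      a * ((a + b) * (a * b) * (u * n)) * (2 ^ s * M) :=
    mul_le_mul_of_nonneg_left h1h (by positivity)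
  have e2 : (a + b) * (|v| + u * n * (|v| + 2)) * 1 ≤
      (a + b) * (|v| + u * n * (|v| + 2)) * (2 ^ s * M) :=
    mul_le_mul_of_nonneg_left h1h (by positivity)
  have e3 : (a + b) * (u * n) * M ≤ (a + b) * (u * n) * (2 ^ s * M) :=
    mul_le_mul_of_nonneg_left hMh (by positivity)
  linarith

/-- Two opposite colour changes far out contradict each other: modulo a common `g`, both colours
would be rare among the same representatives. -/
theorem IsAdmissible.not_noMonoSolution (H : IsAdmissible p a b d u t v) :
    ¬ NoMonoSolution p a b χ Z₀ := by
  intro hχ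
  obtain ⟨n, hn0, hn⟩ := H.exists_top_difference
  obtain ⟨N, hN⟩ := hχ.exists_modulus H hn0 hn
  obtain ⟨k₀, hk₀, hkt₀, hc₀, hd₀⟩ := hχ.exists_switch H true N
  obtain ⟨k₁, hk₁, hkt₁, hc₁, hd₁⟩ := hχ.exists_switch H false N
  obtain ⟨g₀, odd₀, a₀, b₀, hn₀, h₀⟩ := hN k₀ hk₀ hkt₀ (hc₀ ▸ hd₀)
  obtain ⟨g₁, odd₁, a₁, b₁, hn₁, h₁⟩ := hN k₁ hk₁ hkt₁ (hc₁ ▸ hd₁)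
  have hlcm : ((Nat.lcm g₀ g₁ : ℕ) : ℤ) ∣ (g₀ : ℤ) * g₁ := by
    exact_mod_cast Nat.lcm_dvd_mul g₀ g₁
  have hodd : Odd (Nat.lcm g₀ g₁) :=
    odd_of_dvd (m := (g₀ : ℤ) * g₁) (by exact_mod_cast odd₀.mul odd₁) hlcm
  have hca : IsCoprime a (Nat.lcm g₀ g₁ : ℕ) := (a₀.mul_right a₁).of_isCoprime_of_dvd_right hlcm
  have hcb : IsCoprime b (Nat.lcm g₀ g₁ : ℕ) := (b₀.mul_right b₁).of_isCoprime_of_dvd_right hlcm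
  have r₀ := h₀ _ hodd hca hcb (Nat.lcm_dvd hn₀ hn₁) (Nat.dvd_lcm_left _ _)
  have r₁ := h₁ _ hodd hca hcb (Nat.lcm_dvd hn₀ hn₁) (Nat.dvd_lcm_right _ _)
  rw [hc₀] at r₀
  rw [hc₁] at r₁
  have : NeZero (Nat.lcm g₀ g₁) := ⟨hodd.pos.ne'⟩
  rw [Nat.card_eq_fintype_card, Fintype.card_subtype] at r₀ r₁
  have h := Finset.card_filter_add_card_filter_not (s := (Finset.univ : Finset (ZMod (g₀.lcm g₁))))
    (fun α => χ (lowRepresentative u v α) = true)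
  simp only [Bool.not_eq_true, Finset.card_univ, ZMod.card] at h
  omega

end

theorem theorem3 (p : Polynomial ℤ) (hdeg : 2 ≤ p.natDegree) (hlead : 0 < p.leadingCoeff)
    (a b : ℤ) (ha : 0 < a) (hb : 0 < b) (hab : Int.gcd a b = 1)
    (hcond : ∃ d u t v : ℤ, 0 < d ∧ 0 < u ∧
      (a + b) * t ≡ p.eval t [ZMOD d] ∧
      (∀ k : ℤ, k ≡ t [ZMOD d] → a ∣ p.eval (k + d) - p.eval k) ∧
      (∀ k : ℤ, k ≡ t [ZMOD d] →
        u ∣ stepQuotient p a d k ∧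
        ¬ (2 ∣ stepQuotient p a d k / u) ∧
        Int.gcd a (stepQuotient p a d k / u) = 1 ∧
        Int.gcd b (stepQuotient p a d k / u) = 1 ∧
        Int.gcd u (stepQuotient p a d k / u) = 1) ∧
      p.eval v ≡ (a + b) * v [ZMOD u] ∧
      (∀ k : ℤ, k ≡ t [ZMOD d] → p.eval k ≡ (a + b) * v [ZMOD u]) ∧
      (∀ j k : ℤ, j ≡ v [ZMOD u] → k ≡ t [ZMOD d] → b ∣ p.eval k - a * j)) :
    IsRamseyEquation 2 a b p := by
  obtain ⟨d, u, t, v, hd, hu, h1, h2, h3, -, h5, h6⟩ := hcond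
  have hmod {m x y : ℤ} : m ∣ x - y → x ≡ y [ZMOD m] := fun h =>
    (Int.modEq_iff_dvd.mpr h).symm
  have H : IsAdmissible p a b d u t v :=
    { a_pos := ha
      b_pos := hb
      coprime := Int.isCoprime_iff_gcd_eq_one.mpr hab
      d_pos := hd
      u_pos := hu
      natDegree := hdeg
      leadingCoeff := hlead
      dvd_fixed := Int.modEq_iff_dvd.mp h1
      increment := fun k hk => by
        obtain ⟨hum, hodd, hca, hcb, -⟩ := h3 k (hmod hk)
        refine ⟨stepQuotient p a d k / u, ?_, ?_, Int.isCoprime_iff_gcd_eq_one.mpr hca,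
          Int.isCoprime_iff_gcd_eq_one.mpr hcb⟩
        · rw [Int.mul_ediv_cancel' hum, stepQuotient, Int.mul_ediv_cancel' (h2 k (hmod hk))]
        · rwa [← Int.not_even_iff_odd, even_iff_two_dvd]
      dvd_eval := fun k hk => Int.modEq_iff_dvd.mp (h5 k (hmod hk)).symm
      dvd_solution := fun j k hj hk => h6 j k (hmod hj) (hmod hk) }
  intro φ hfin
  obtain ⟨Z₀, hZ₀⟩ := (hfin.image fun s => (s.2.2 : ℤ)).bddAbove
  refine H.not_noMonoSolution (χ := fun i => decide (φ i.toNat.toPNat' = 0)) (Z₀ := |Z₀|) ?_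
  rintro x y z hx hy hz hxyz ⟨hxz, hyz⟩
  have hz0 : 0 < z := (abs_nonneg Z₀).trans_lt hz
  have hcast {i : ℤ} (hi : 0 < i) : ((i.toNat.toPNat' : ℕ) : ℤ) = i := by
    rw [Nat.toPNat'_coe, if_pos (by omega)]
    exact Int.toNat_of_nonneg hi.le
  have hcol {i j : ℕ+} (h : decide (φ i = 0) = decide (φ j = 0)) : φ i = φ j := by
    rw [decide_eq_decide] at h
    omega
  have hmem := hZ₀ (Set.mem_image_of_mem _
    (show (x.toNat.toPNat', y.toNat.toPNat', z.toNat.toPNat') ∈ {s : ℕ+ × ℕ+ × ℕ+ |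
      a * (s.1 : ℤ) + b * (s.2.1 : ℤ) = p.eval (s.2.2 : ℤ) ∧
      φ s.1 = φ s.2.1 ∧ φ s.2.1 = φ s.2.2} from
      ⟨by simpa only [hcast hx, hcast hy, hcast hz0] using hxyz, hcol (hxz.trans hyz.symm),
        hcol hyz⟩))
  simp only [hcast hz0] at hmem
  exact (hz.trans_le hmem).not_ge (le_abs_self Z₀)
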